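/- For integers $\ell,m\ge 1$ define $p_n(\ell,m)$ by $$\binom{m+\ell}{m}_q=\frac{(q^{m+1}-1)\cdots(q^{m+\ell}-1)}{(q-1)\cdots(q^{\ell}-1)}=\sum_{n=0}^{\ell m}p_n(\ell,m)\,q^n ,$$ and say that $(\circ)$ holds for $(\ell,m)$ if $$p_1(\ell,m)<\cdots<p_{\lfloor \ell m/2\rfloor}(\ell,m)=p_{\lceil \ell m/2\rceil}(\ell,m)>\cdots>p_{\ell m-1}(\ell,m).$$ Let $\ell,m_1,m_2\ge 2$ be integers, at least one of which is even and at least one of which is $\ge 3$. If $(\circ)$ holds for $(\ell,m_1)$ and for $(\ell,m_2)$, then $(\circ)$ holds for $(\ell,m_1+m_2)$. -/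

import Mathlib

open Polynomial

noncomputable section

/-- The numerator `(q^(m+1) - 1) ⋯ (q^(m+ℓ) - 1)`. -/
def qNum (ℓ m : ℕ) : ℤ[X] := ∏ i ∈ Finset.range ℓ, (X ^ (m + (i + 1)) - 1)

/-- The denominator `(q - 1) ⋯ (q^ℓ - 1)`. -/
def qDen (ℓ : ℕ) : ℤ[X] := ∏ i ∈ Finset.range ℓ, (X ^ (i + 1) - 1)

/-- The `q`-binomial coefficient `(m + ℓ choose m)_q`, as a polynomial in `q` over `ℤ`: the
quotient of `qNum ℓ m` by the monic polynomial `qDen ℓ`. The division is exact, see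
`qBinomial_mul_qDen`. -/
def qBinomial (ℓ m : ℕ) : ℤ[X] := qNum ℓ m /ₘ qDen ℓ

/-- `p_n(ℓ, m)`, the coefficient of `q^n` in `(m + ℓ choose m)_q`. -/
def qCoeff (n ℓ m : ℕ) : ℤ := (qBinomial ℓ m).coeff n

/-- The strict unimodality inequalities
`p_1 < ⋯ < p_⌊ℓm/2⌋ = p_⌈ℓm/2⌉ > ⋯ > p_(ℓm-1)`, where `p_n = p_n(ℓ, m)`. -/
def StrictlyUnimodal (ℓ m : ℕ) : Prop :=
  (∀ i : ℕ, 1 ≤ i → i + 1 ≤ ⌊(ℓ * m : ℚ) / 2⌋₊ → qCoeff i ℓ m < qCoeff (i + 1) ℓ m) ∧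
  qCoeff ⌊(ℓ * m : ℚ) / 2⌋₊ ℓ m = qCoeff ⌈(ℓ * m : ℚ) / 2⌉₊ ℓ m ∧
  (∀ i : ℕ, ⌈(ℓ * m : ℚ) / 2⌉₊ ≤ i → i + 1 < ℓ * m → qCoeff (i + 1) ℓ m < qCoeff i ℓ m)

theorem qDen_monic (ℓ : ℕ) : (qDen ℓ).Monic :=
  monic_prod_of_monic _ _ fun i _ => monic_X_pow_sub_C (1 : ℤ) (Nat.succ_ne_zero i)

theorem qDen_dvd_qNum (ℓ m : ℕ) : qDen ℓ ∣ qNum ℓ m := by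
  induction ℓ generalizing m with
  | zero => simp [qDen, qNum]
  | succ ℓ ihℓ =>
    induction m with
    | zero => simp [qDen, qNum]
    | succ m ihm =>
      have h1 : qNum (ℓ + 1) (m + 1)
          = qNum ℓ (m + 1) * (X ^ (ℓ + 1) - 1) * X ^ (m + 1) + qNum (ℓ + 1) m := by
        have h2 : qNum (ℓ + 1) m = qNum ℓ (m + 1) * (X ^ (m + 1) - 1) := by
          unfold qNum
          rw [Finset.prod_range_succ']
          congr 1
          refine Finset.prod_congr rfl fun i _ => ?_
          congr 2
          omega
        have h3 : qNum (ℓ + 1) (m + 1) = qNum ℓ (m + 1) * (X ^ (m + 1 + (ℓ + 1)) - 1) := by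
          unfold qNum
          rw [Finset.prod_range_succ]
        rw [h2, h3]
        ring
      have h4 : qDen (ℓ + 1) = qDen ℓ * (X ^ (ℓ + 1) - 1) := by
        unfold qDen
        rw [Finset.prod_range_succ]
      rw [h1]
      exact dvd_add (Dvd.dvd.mul_right (h4 ▸ mul_dvd_mul_right (ihℓ (m + 1)) _) _) ihm

theorem qBinomial_mul_qDen (ℓ m : ℕ) : qBinomial ℓ m * qDen ℓ = qNum ℓ m := by
  have h := modByMonic_add_div (qNum ℓ m) (qDen ℓ)
  rw [(modByMonic_eq_zero_iff_dvd (qDen_monic ℓ)).2 (qDen_dvd_qNum ℓ m), zero_add] at h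
  rw [mul_comm]
  exact h

end

/-! The coefficient of `q^k` is the dimension of the space of polynomials in `x_0, …, x_ℓ` of degree
`m` and weight `k`, a weight space of the `sl₂`-module `Sym^m(V_ℓ)`. Below the middle, raising is
onto (`exists_raising_eq`), so the coefficient strictly increases at `k` exactly when raising kills
some nonzero vector of weight `k`. Raising is a derivation and the ring is a domain, so products of
such vectors are again such vectors (`HasHighestWeightVector.add`). They exist for `m₁` and `m₂` in
every weight up to the middle except possibly 1, and sums of two such weights reach every required
weight for `m₁ + m₂`. -/

open Polynomial

noncomputable section

/-! ### Gaussian coefficients as counts of tuples -/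

/-- The weight `∑ i * d i` of a tuple of exponents. -/
def tupleWeight {n : ℕ} (d : Fin n → ℕ) : ℕ := ∑ i : Fin n, (i : ℕ) * d i

/-- The generating function, by weight, of the `(ℓ + 1)`-tuples of natural numbers with sum `m`. -/
def tupleGenFun (ℓ m : ℕ) : ℤ[X] :=
  ∑ d ∈ Finset.Nat.antidiagonalTuple (ℓ + 1) m, X ^ tupleWeight d

/-- The `(ℓ + 1)`-tuples of natural numbers with sum `m` and weight `k`. -/
def tuplesOfWeight (ℓ m k : ℕ) : Finset (Fin (ℓ + 1) → ℕ) :=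
  (Finset.Nat.antidiagonalTuple (ℓ + 1) m).filter fun d => tupleWeight d = k

theorem mem_tuplesOfWeight {ℓ m k : ℕ} {d : Fin (ℓ + 1) → ℕ} :
    d ∈ tuplesOfWeight ℓ m k ↔ ∑ i, d i = m ∧ tupleWeight d = k := by
  simp [tuplesOfWeight, Finset.Nat.mem_antidiagonalTuple]

theorem coeff_tupleGenFun (ℓ m k : ℕ) :
    (tupleGenFun ℓ m).coeff k = (tuplesOfWeight ℓ m k).card := by
  simp only [tupleGenFun, finsetSum_coeff, coeff_X_pow, tuplesOfWeight, Finset.card_filter]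
  push_cast
  exact Finset.sum_congr rfl fun d _ => by simp [eq_comm]

theorem tupleWeight_cons {n : ℕ} (a : ℕ) (d : Fin n → ℕ) :
    tupleWeight (Fin.cons a d : Fin (n + 1) → ℕ) = ∑ i, d i + tupleWeight d := by
  simp [tupleWeight, Fin.sum_univ_succ, add_mul, Finset.sum_add_distrib, add_comm]

theorem tupleWeight_eq_sum_tail {n : ℕ} (d : Fin (n + 1) → ℕ) :
    tupleWeight d = ∑ i, Fin.tail d i + tupleWeight (Fin.tail d) := by
  conv_lhs => rw [← Fin.cons_self_tail d]
  exact tupleWeight_cons _ _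

theorem tupleGenFun_zero_left (m : ℕ) : tupleGenFun 0 m = 1 := by
  simp [tupleGenFun, tupleWeight]

theorem tupleGenFun_zero_right (ℓ : ℕ) : tupleGenFun ℓ 0 = 1 := by
  simp [tupleGenFun, tupleWeight, Finset.Nat.antidiagonalTuple_zero_right]

/-- Split on `d 0 = 0`. Deleting a leading zero shifts every index down and costs weight `m + 1`;
decrementing a positive `d 0` costs none. -/
theorem tupleGenFun_succ_succ (ℓ m : ℕ) :
    tupleGenFun (ℓ + 1) (m + 1) =
      tupleGenFun ℓ (m + 1) * X ^ (m + 1) + tupleGenFun (ℓ + 1) m := by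
  unfold tupleGenFun
  rw [← Finset.sum_filter_add_sum_filter_not _ (fun d : Fin (ℓ + 1 + 1) → ℕ => d 0 = 0)]
  congr 1
  · rw [Finset.sum_mul]
    refine Finset.sum_nbij' Fin.tail (fun d => Fin.cons 0 d) ?_ ?_ ?_ ?_ ?_
    · intro d hd
      simp only [Finset.mem_filter, Finset.Nat.mem_antidiagonalTuple] at hd ⊢
      rw [Fin.sum_univ_succ, hd.2, zero_add] at hd
      exact hd.1
    · intro d hd
      simp only [Finset.mem_filter, Finset.Nat.mem_antidiagonalTuple] at hd ⊢
      simp [Fin.sum_univ_succ (n := ℓ + 1), hd]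
    · intro d hd
      simp only [Finset.mem_filter] at hd
      rw [← hd.2, Fin.cons_self_tail]
    · intro d _
      exact Fin.tail_cons _ _
    · intro d hd
      simp only [Finset.mem_filter, Finset.Nat.mem_antidiagonalTuple] at hd
      rw [Fin.sum_univ_succ, hd.2, zero_add] at hd
      rw [tupleWeight_eq_sum_tail, ← pow_add, add_comm]
      congr 2
      exact hd.1
  · refine Finset.sum_nbij' (fun d => Fin.cons (d 0 - 1) (Fin.tail d))
      (fun d => Fin.cons (d 0 + 1) (Fin.tail d)) ?_ ?_ ?_ ?_ ?_
    · intro d hd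
      simp only [Finset.mem_filter, Finset.Nat.mem_antidiagonalTuple] at hd ⊢
      rw [Fin.sum_univ_succ] at hd ⊢
      simp only [Fin.cons_zero, Fin.cons_succ, Fin.tail]
      omega
    · intro d hd
      simp only [Finset.mem_filter, Finset.Nat.mem_antidiagonalTuple] at hd ⊢
      rw [Fin.sum_univ_succ] at hd ⊢
      simp only [Fin.cons_zero, Fin.cons_succ, Fin.tail]
      omega
    · intro d hd
      simp only [Finset.mem_filter] at hd
      simp only [Fin.cons_zero, Fin.tail_cons]
      rw [Nat.sub_add_cancel (Nat.pos_of_ne_zero hd.2), Fin.cons_self_tail]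
    · intro d _
      simp only [Fin.cons_zero, Fin.tail_cons, Nat.add_sub_cancel]
      rw [Fin.cons_self_tail]
    · intro d _
      rw [tupleWeight_cons, tupleWeight_eq_sum_tail]

theorem qBinomial_zero_left (m : ℕ) : qBinomial 0 m = 1 := by
  simpa [qDen, qNum] using qBinomial_mul_qDen 0 m

theorem qBinomial_zero_right (ℓ : ℕ) : qBinomial ℓ 0 = 1 := by
  refine mul_right_cancel₀ (qDen_monic ℓ).ne_zero ?_
  rw [qBinomial_mul_qDen]
  simp [qDen, qNum]

theorem qBinomial_succ_succ (ℓ m : ℕ) :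
    qBinomial (ℓ + 1) (m + 1) =
      qBinomial ℓ (m + 1) * X ^ (m + 1) + qBinomial (ℓ + 1) m := by
  refine mul_right_cancel₀ (qDen_monic (ℓ + 1)).ne_zero ?_
  have h2 : qNum (ℓ + 1) m = qNum ℓ (m + 1) * (X ^ (m + 1) - 1) := by
    unfold qNum
    rw [Finset.prod_range_succ']
    congr 1
    refine Finset.prod_congr rfl fun i _ => ?_
    congr 2
    omega
  have h3 : qNum (ℓ + 1) (m + 1) = qNum ℓ (m + 1) * (X ^ (m + 1 + (ℓ + 1)) - 1) := by
    unfold qNum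
    rw [Finset.prod_range_succ]
  have h4 : qDen (ℓ + 1) = qDen ℓ * (X ^ (ℓ + 1) - 1) := by
    unfold qDen
    rw [Finset.prod_range_succ]
  rw [add_mul, qBinomial_mul_qDen, qBinomial_mul_qDen, h2, h3, h4, ← qBinomial_mul_qDen]
  ring

theorem qBinomial_eq_tupleGenFun (ℓ m : ℕ) : qBinomial ℓ m = tupleGenFun ℓ m := by
  induction ℓ generalizing m with
  | zero => rw [qBinomial_zero_left, tupleGenFun_zero_left]
  | succ ℓ ihℓ =>
    induction m with
    | zero => rw [qBinomial_zero_right, tupleGenFun_zero_right]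
    | succ m ihm => rw [qBinomial_succ_succ, tupleGenFun_succ_succ, ihℓ, ihm]

theorem qCoeff_eq_card (k ℓ m : ℕ) : qCoeff k ℓ m = (tuplesOfWeight ℓ m k).card := by
  rw [qCoeff, qBinomial_eq_tupleGenFun, coeff_tupleGenFun]

theorem tupleWeight_rev {ℓ : ℕ} (d : Fin (ℓ + 1) → ℕ) :
    tupleWeight (fun i => d i.rev) + tupleWeight d = ℓ * ∑ i, d i := by
  have h : tupleWeight (fun i => d i.rev) = ∑ i : Fin (ℓ + 1), (i.rev : ℕ) * d i :=
    Fintype.sum_equiv Fin.revPerm _ _ fun i => by simp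
  rw [h, tupleWeight, ← Finset.sum_add_distrib, Finset.mul_sum]
  refine Finset.sum_congr rfl fun i _ => ?_
  rw [← add_mul, Fin.val_rev]
  congr 1
  omega

theorem qCoeff_symm {ℓ m j k : ℕ} (h : j + k = ℓ * m) : qCoeff j ℓ m = qCoeff k ℓ m := by
  rw [qCoeff_eq_card, qCoeff_eq_card, Nat.cast_inj]
  have key : ∀ {j k : ℕ}, j + k = ℓ * m → ∀ d ∈ tuplesOfWeight ℓ m j,
      (fun i => d (Fin.rev i)) ∈ tuplesOfWeight ℓ m k := by
    intro j k h d hd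
    rw [mem_tuplesOfWeight] at hd ⊢
    have h1 := tupleWeight_rev d
    rw [hd.1] at h1
    exact ⟨(Fintype.sum_equiv Fin.revPerm _ _ fun i => by simp).trans hd.1, by omega⟩
  exact Finset.card_nbij' (fun d i => d (Fin.rev i)) (fun d i => d (Fin.rev i))
    (key h) (key (by omega)) (fun d _ => by simp) (fun d _ => by simp)

/-! ### Derivations and weighted homogeneity -/

open MvPolynomial in
/-- A derivation which shifts the weights of the variables by `δ` shifts all weights by `δ`. -/
theorem mkDerivation_isWeightedHomogeneous {σ R M : Type*} [CommRing R] [AddCommGroup M]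
    (w : σ → M) (f : σ → MvPolynomial σ R) (δ : M)
    (hf : ∀ i, IsWeightedHomogeneous w (f i) (w i + δ)) {p : MvPolynomial σ R} {n : M}
    (hp : IsWeightedHomogeneous w p n) :
    IsWeightedHomogeneous w (mkDerivation R f p) (n + δ) := by
  rw [p.as_sum, map_sum]
  refine IsWeightedHomogeneous.sum _ _ _ fun s hs => ?_
  rw [mkDerivation_monomial, Finsupp.sum, MvPolynomial.smul_eq_C_mul]
  refine IsWeightedHomogeneous.C_mul (IsWeightedHomogeneous.sum _ _ _ fun i hi => ?_) _
  have h1 : Finsupp.weight w s = n := hp (mem_support_iff.1 hs)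
  have h2 := Finsupp.weight_sub_single_add (w := w) (Finsupp.mem_support_iff.1 hi)
  have h3 := (isWeightedHomogeneous_monomial w (s - Finsupp.single i 1) ((s i : ℕ) : R) rfl).mul
    (hf i)
  rwa [← add_assoc, h2, h1] at h3

open MvPolynomial in
/-- Euler's identity: a diagonal derivation acts on a weight space as a scalar. -/
theorem mkDerivation_smul_X_eq_smul {σ R M : Type*} [CommRing R] [AddCommGroup M]
    (w : σ → M) (c : M →+ R) {p : MvPolynomial σ R} {n : M} (hp : IsWeightedHomogeneous w p n) :
    mkDerivation R (fun i => c (w i) • (X i : MvPolynomial σ R)) p = c n • p := by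
  conv_lhs => rw [p.as_sum]
  conv_rhs => rw [p.as_sum]
  rw [map_sum, Finset.smul_sum]
  refine Finset.sum_congr rfl fun s hs => ?_
  have h1 : Finsupp.weight w s = n := hp (mem_support_iff.1 hs)
  rw [mkDerivation_monomial, ← h1, Finsupp.weight_apply, map_finsuppSum, Finsupp.sum, Finsupp.sum,
    Finset.smul_sum, Finset.sum_smul]
  refine Finset.sum_congr rfl fun i hi => ?_
  have h2 : s - Finsupp.single i 1 + Finsupp.single i 1 = s :=
    Finsupp.sub_add_single_one_cancel (Finsupp.mem_support_iff.1 hi)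
  rw [MvPolynomial.X, MvPolynomial.smul_monomial, smul_eq_mul, smul_eq_mul,
    MvPolynomial.monomial_mul, h2, MvPolynomial.smul_monomial, MvPolynomial.smul_monomial]
  simp only [smul_eq_mul, map_nsmul, nsmul_eq_mul, mul_one]
  congr 1
  ring

/-! ### The `sl₂`-action on polynomials -/

/-- Degree and weight of the variables `x_0, …, x_ℓ`. -/
def varWeight (ℓ : ℕ) (i : Fin (ℓ + 1)) : ℤ × ℤ := (1, (i : ℤ))

/-- Polynomials in `x_0, …, x_ℓ` of degree `m` and weight `k`. -/
abbrev weightSpace (ℓ : ℕ) (m k : ℤ) : Submodule ℚ (MvPolynomial (Fin (ℓ + 1)) ℚ) :=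
  MvPolynomial.weightedHomogeneousSubmodule ℚ (varWeight ℓ) (m, k)

/-- The derivation `x_i ↦ i x_{i-1}`. -/
def raising (ℓ : ℕ) :
    Derivation ℚ (MvPolynomial (Fin (ℓ + 1)) ℚ) (MvPolynomial (Fin (ℓ + 1)) ℚ) :=
  MvPolynomial.mkDerivation ℚ fun i =>
    -- At `i = 0` the index truncates, but the coefficient vanishes.
    ((i : ℕ) : ℚ) • MvPolynomial.X ⟨(i : ℕ) - 1, by omega⟩

/-- The derivation `x_i ↦ (ℓ - i) x_{i+1}`. -/
def lowering (ℓ : ℕ) :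
    Derivation ℚ (MvPolynomial (Fin (ℓ + 1)) ℚ) (MvPolynomial (Fin (ℓ + 1)) ℚ) :=
  MvPolynomial.mkDerivation ℚ fun i =>
    -- Likewise at `i = ℓ`, where `min` only keeps the index in range.
    ((ℓ : ℚ) - ((i : ℕ) : ℚ)) • MvPolynomial.X ⟨min ((i : ℕ) + 1) ℓ, by omega⟩

theorem finsuppWeight_varWeight {ℓ : ℕ} (d : Fin (ℓ + 1) →₀ ℕ) :
    Finsupp.weight (varWeight ℓ) d = (((∑ i, d i : ℕ) : ℤ), ((tupleWeight d : ℕ) : ℤ)) := by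
  rw [Finsupp.weight_eq_sum]
  ext
  · simp [varWeight, Prod.fst_sum]
  · simp [varWeight, tupleWeight, Prod.snd_sum, mul_comm]

theorem raising_mem {ℓ : ℕ} {m k : ℤ} {p : MvPolynomial (Fin (ℓ + 1)) ℚ}
    (hp : p ∈ weightSpace ℓ m k) : raising ℓ p ∈ weightSpace ℓ m (k - 1) := by
  have h := mkDerivation_isWeightedHomogeneous (varWeight ℓ) (fun i =>
    ((i : ℕ) : ℚ) • MvPolynomial.X ⟨(i : ℕ) - 1, by omega⟩) (0, -1) (fun i => ?_) hp
  · rw [Prod.mk_add_mk, add_zero, ← sub_eq_add_neg] at h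
    exact h
  · rcases Nat.eq_zero_or_pos (i : ℕ) with h0 | h0
    · simp only [h0, Nat.cast_zero, zero_smul]
      exact MvPolynomial.isWeightedHomogeneous_zero _ _ _
    · rw [MvPolynomial.smul_eq_C_mul]
      refine MvPolynomial.IsWeightedHomogeneous.C_mul ?_ _
      have h1 : varWeight ℓ ⟨(i : ℕ) - 1, by omega⟩ = varWeight ℓ i + (0, -1) := by
        simp only [varWeight, Prod.mk_add_mk, Prod.mk.injEq]
        omega
      exact h1 ▸ MvPolynomial.isWeightedHomogeneous_X ℚ (varWeight ℓ) _

theorem lowering_mem {ℓ : ℕ} {m k : ℤ} {p : MvPolynomial (Fin (ℓ + 1)) ℚ}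
    (hp : p ∈ weightSpace ℓ m k) : lowering ℓ p ∈ weightSpace ℓ m (k + 1) := by
  have h := mkDerivation_isWeightedHomogeneous (varWeight ℓ) (fun i =>
    ((ℓ : ℚ) - ((i : ℕ) : ℚ)) • MvPolynomial.X ⟨min ((i : ℕ) + 1) ℓ, by omega⟩) (0, 1)
    (fun i => ?_) hp
  · rw [Prod.mk_add_mk, add_zero] at h
    exact h
  · rcases Nat.lt_or_ge (i : ℕ) ℓ with h0 | h0
    · rw [MvPolynomial.smul_eq_C_mul]
      refine MvPolynomial.IsWeightedHomogeneous.C_mul ?_ _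
      have h1 : varWeight ℓ ⟨min ((i : ℕ) + 1) ℓ, by omega⟩ = varWeight ℓ i + (0, 1) := by
        simp only [varWeight, Prod.mk_add_mk, Prod.mk.injEq]
        omega
      exact h1 ▸ MvPolynomial.isWeightedHomogeneous_X ℚ (varWeight ℓ) _
    · have h1 : (i : ℕ) = ℓ := by omega
      simp only [h1, sub_self, zero_smul]
      exact MvPolynomial.isWeightedHomogeneous_zero _ _ _

theorem lie_raising_lowering (ℓ : ℕ) :
    ⁅raising ℓ, lowering ℓ⁆ = MvPolynomial.mkDerivation ℚ fun i : Fin (ℓ + 1) =>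
      ((ℓ : ℚ) - 2 * ((i : ℕ) : ℚ)) • (MvPolynomial.X i : MvPolynomial (Fin (ℓ + 1)) ℚ) := by
  refine MvPolynomial.derivation_ext fun i => ?_
  rw [Derivation.commutator_apply]
  simp only [raising, lowering, MvPolynomial.mkDerivation_X, Derivation.map_smul, smul_smul]
  have h1 : (((ℓ : ℚ) - ((i : ℕ) : ℚ)) * ((min ((i : ℕ) + 1) ℓ : ℕ) : ℚ)) •
      (MvPolynomial.X ⟨min ((i : ℕ) + 1) ℓ - 1, by omega⟩ : MvPolynomial (Fin (ℓ + 1)) ℚ) =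
      (((ℓ : ℚ) - ((i : ℕ) : ℚ)) * (((i : ℕ) : ℚ) + 1)) • MvPolynomial.X i := by
    rcases Nat.lt_or_ge (i : ℕ) ℓ with h0 | h0
    · have h2 : min ((i : ℕ) + 1) ℓ = i + 1 := by omega
      simp [h2]
    · have h2 : (i : ℕ) = ℓ := by omega
      simp [h2]
  have h2 : (((i : ℕ) : ℚ) * ((ℓ : ℚ) - (((i : ℕ) - 1 : ℕ) : ℚ))) •
      (MvPolynomial.X ⟨min ((i : ℕ) - 1 + 1) ℓ, by omega⟩ : MvPolynomial (Fin (ℓ + 1)) ℚ) =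
      (((i : ℕ) : ℚ) * ((ℓ : ℚ) - ((i : ℕ) : ℚ) + 1)) • MvPolynomial.X i := by
    rcases Nat.eq_zero_or_pos (i : ℕ) with h0 | h0
    · simp [h0]
    · have h3 : (⟨min ((i : ℕ) - 1 + 1) ℓ, by omega⟩ : Fin (ℓ + 1)) = i := by
        ext
        simp only
        omega
      rw [h3, Nat.cast_sub h0]
      congr 1
      push_cast
      ring
  rw [h1, h2, ← sub_smul]
  congr 1
  ring

theorem raising_lowering {ℓ : ℕ} {m k : ℤ} {p : MvPolynomial (Fin (ℓ + 1)) ℚ}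
    (hp : p ∈ weightSpace ℓ m k) :
    raising ℓ (lowering ℓ p) =
      lowering ℓ (raising ℓ p) + ((ℓ : ℚ) * m - 2 * k) • p := by
  let c : ℤ × ℤ →+ ℚ :=
    { toFun := fun x => (ℓ : ℚ) * x.1 - 2 * x.2
      map_zero' := by simp
      map_add' := fun x y => by
        simp only [Prod.fst_add, Prod.snd_add]
        push_cast
        ring }
  have h := mkDerivation_smul_X_eq_smul (varWeight ℓ) c hp
  have h2 := congrArg (fun D => D p) (lie_raising_lowering ℓ)
  simp only [Derivation.commutator_apply] at h2
  rw [← sub_eq_iff_eq_add', h2]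
  refine Eq.trans ?_ h
  simp [c, varWeight]

theorem weightSpace_eq_zero_of_neg {ℓ : ℕ} {m k : ℤ} (hk : k < 0)
    {p : MvPolynomial (Fin (ℓ + 1)) ℚ} (hp : p ∈ weightSpace ℓ m k) : p = 0 := by
  by_contra hne
  obtain ⟨d, hd⟩ := MvPolynomial.ne_zero_iff.1 hne
  have h := hp hd
  rw [finsuppWeight_varWeight, Prod.mk.injEq] at h
  omega

theorem raising_iterate_mem {ℓ : ℕ} {m k : ℤ} (j : ℕ) {p : MvPolynomial (Fin (ℓ + 1)) ℚ}
    (hp : p ∈ weightSpace ℓ m k) : (raising ℓ)^[j] p ∈ weightSpace ℓ m (k - j) := by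
  induction j with
  | zero => simpa using hp
  | succ j ih =>
    rw [Function.iterate_succ_apply']
    have := raising_mem ih
    rwa [sub_sub, ← Nat.cast_succ] at this

/-- The `sl₂` identity `e^(j+1) f = f e^(j+1) + (j+1) e^j (h+j)`, with `h` acting by `ℓm - 2k`. -/
theorem raising_iterate_lowering {ℓ : ℕ} {m k : ℤ} (j : ℕ) {p : MvPolynomial (Fin (ℓ + 1)) ℚ}
    (hp : p ∈ weightSpace ℓ m k) :
    (raising ℓ)^[j + 1] (lowering ℓ p) = lowering ℓ ((raising ℓ)^[j + 1] p) +
      ((j + 1 : ℚ) * ((ℓ : ℚ) * m - 2 * k + j)) • (raising ℓ)^[j] p := by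
  induction j with
  | zero => simpa using raising_lowering hp
  | succ j ih =>
    rw [Function.iterate_succ_apply', ih, map_add, Derivation.map_smul,
      raising_lowering (raising_iterate_mem (j + 1) hp), ← Function.iterate_succ_apply' (raising ℓ),
      ← Function.iterate_succ_apply' (raising ℓ), add_assoc, ← add_smul]
    congr 2
    push_cast
    ring

/-- The raising operator maps onto every weight space of positive `sl₂`-weight. -/
theorem exists_raising_eq {ℓ : ℕ} {m k : ℤ} (hk : 2 * k < ℓ * m)
    {p : MvPolynomial (Fin (ℓ + 1)) ℚ} (hp : p ∈ weightSpace ℓ m k) :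
    ∃ q ∈ weightSpace ℓ m (k + 1), raising ℓ q = p := by
  have hk' : (2 * k : ℚ) < ℓ * m := by exact_mod_cast hk
  -- Induction on the power of raising that kills `p`: by `raising_iterate_lowering`, subtracting
  -- `c⁻¹ e f p`, which lies in the image, lowers that power by one.
  have key : ∀ (j : ℕ) (p : MvPolynomial (Fin (ℓ + 1)) ℚ), p ∈ weightSpace ℓ m k →
      (raising ℓ)^[j] p = 0 → ∃ q ∈ weightSpace ℓ m (k + 1), raising ℓ q = p := by
    intro j
    induction j with
    | zero => exact fun p _ h0 => ⟨0, Submodule.zero_mem _, by simpa using h0.symm⟩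
    | succ j ih =>
      intro p hp h0
      have hpos : (0 : ℚ) < (j + 1 : ℚ) * ((ℓ : ℚ) * m - 2 * k + j) := by
        have : (0 : ℚ) ≤ j := j.cast_nonneg
        exact mul_pos (by linarith) (by linarith)
      set c : ℚ := (j + 1 : ℚ) * ((ℓ : ℚ) * m - 2 * k + j) with hc
      have hlow := lowering_mem hp
      have hmem : raising ℓ (lowering ℓ p) ∈ weightSpace ℓ m k := by
        simpa using raising_mem hlow
      obtain ⟨q, hq, hqp⟩ := ih (p - c⁻¹ • raising ℓ (lowering ℓ p))
        (Submodule.sub_mem _ hp (Submodule.smul_mem _ _ hmem)) (by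
          have hlin : ∀ x y : MvPolynomial (Fin (ℓ + 1)) ℚ, (raising ℓ)^[j] (x - c⁻¹ • y) =
              (raising ℓ)^[j] x - c⁻¹ • (raising ℓ)^[j] y := by
            intro x y
            have := map_sub ((raising ℓ).toLinearMap ^ j) x (c⁻¹ • y)
            rw [map_smul] at this
            simpa only [Module.End.pow_apply, Derivation.coeFn_coe] using this
          rw [hlin, ← Function.iterate_succ_apply (raising ℓ), raising_iterate_lowering j hp, h0,
            map_zero, zero_add, smul_smul, inv_mul_cancel₀ hpos.ne', one_smul, sub_self])
      refine ⟨q + c⁻¹ • lowering ℓ p,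
        Submodule.add_mem _ hq (Submodule.smul_mem _ _ hlow), ?_⟩
      rw [map_add, hqp, Derivation.map_smul, sub_add_cancel]
  -- That many steps make the weight negative.
  refine key (k.toNat + 1) p hp (weightSpace_eq_zero_of_neg ?_ (raising_iterate_mem _ hp))
  push_cast
  omega

/-! ### Coefficients as dimensions -/

/-- The exponents of the monomials in `weightSpace ℓ m k`. -/
def weightExponentsEquiv (ℓ m k : ℕ) :
    {d : Fin (ℓ + 1) →₀ ℕ | Finsupp.weight (varWeight ℓ) d = ((m : ℤ), (k : ℤ))} ≃
      tuplesOfWeight ℓ m k :=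
  Finsupp.equivFunOnFinite.subtypeEquiv fun d => by
    simp only [Set.mem_ofPred_eq, finsuppWeight_varWeight, Prod.mk.injEq, Nat.cast_inj,
      mem_tuplesOfWeight]
    rfl

/-- The monomial basis of `weightSpace ℓ m k`. -/
def weightSpaceBasis (ℓ m k : ℕ) :
    Module.Basis (tuplesOfWeight ℓ m k) ℚ (weightSpace ℓ m k) :=
  ((MvPolynomial.basisRestrictSupport ℚ
    {d | Finsupp.weight (varWeight ℓ) d = ((m : ℤ), (k : ℤ))}).map
      (LinearEquiv.ofEq _ _
        (MvPolynomial.weightedHomogeneousSubmodule_eq_finsupp_supported ℚ _ _).symm)).reindex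
    (weightExponentsEquiv ℓ m k)

instance (ℓ m k : ℕ) : FiniteDimensional ℚ (weightSpace ℓ m k) :=
  (weightSpaceBasis ℓ m k).finiteDimensional_of_finite

theorem qCoeff_eq_finrank (k ℓ m : ℕ) :
    qCoeff k ℓ m = Module.finrank ℚ (weightSpace ℓ m k) := by
  rw [qCoeff_eq_card, Module.finrank_eq_card_basis (weightSpaceBasis ℓ m k), Fintype.card_coe]

/-! ### Highest weight vectors and strict increase -/

/-- Existence of a highest weight vector in degree `m` and weight `k`. -/
def HasHighestWeightVector (ℓ m k : ℕ) : Prop :=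
  ∃ p ∈ weightSpace ℓ m k, raising ℓ p = 0 ∧ p ≠ 0

theorem HasHighestWeightVector.add {ℓ m₁ m₂ k₁ k₂ : ℕ} (h₁ : HasHighestWeightVector ℓ m₁ k₁)
    (h₂ : HasHighestWeightVector ℓ m₂ k₂) :
    HasHighestWeightVector ℓ (m₁ + m₂) (k₁ + k₂) := by
  obtain ⟨p, hp, hEp, hp0⟩ := h₁
  obtain ⟨q, hq, hEq, hq0⟩ := h₂
  refine ⟨p * q, ?_, ?_, mul_ne_zero hp0 hq0⟩
  · have := MvPolynomial.IsWeightedHomogeneous.mul hp hq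
    rw [Prod.mk_add_mk] at this
    rw [Nat.cast_add, Nat.cast_add]
    exact this
  · rw [Derivation.leibniz, hEp, hEq, smul_zero, smul_zero, add_zero]

theorem hasHighestWeightVector_zero (ℓ m : ℕ) : HasHighestWeightVector ℓ m 0 := by
  refine ⟨MvPolynomial.X 0 ^ m, ?_, ?_, pow_ne_zero _ (MvPolynomial.X_ne_zero _)⟩
  · have := (MvPolynomial.isWeightedHomogeneous_X ℚ (varWeight ℓ) 0).pow m
    simpa [varWeight] using this
  · rw [Derivation.leibniz_pow, raising, MvPolynomial.mkDerivation_X]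
    simp

/-- The raising operator as a map between weight spaces. -/
def raisingMap (ℓ m k : ℕ) : weightSpace ℓ m (k + 1 : ℕ) →ₗ[ℚ] weightSpace ℓ m k :=
  (raising ℓ).toLinearMap.restrict fun p hp => by
    have := raising_mem hp
    rwa [Nat.cast_succ, add_sub_cancel_right] at this

theorem hasHighestWeightVector_of_qCoeff_lt {ℓ m k : ℕ} (h : qCoeff k ℓ m < qCoeff (k + 1) ℓ m) :
    HasHighestWeightVector ℓ m (k + 1) := by
  rw [qCoeff_eq_finrank, qCoeff_eq_finrank, Nat.cast_lt] at h
  obtain ⟨x, hx, hx0⟩ := Submodule.exists_mem_ne_zero_of_ne_bot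
    (LinearMap.ker_ne_bot_of_finrank_lt (f := raisingMap ℓ m k) h)
  exact ⟨x, x.2, congrArg Subtype.val (LinearMap.mem_ker.1 hx), fun h0 => hx0 (Subtype.ext h0)⟩

/-- Rank-nullity: below the middle the difference of the coefficients is the dimension of the kernel
of raising. -/
theorem qCoeff_lt_of_hasHighestWeightVector {ℓ m k : ℕ} (hk : 2 * (k + 1) ≤ ℓ * m)
    (h : HasHighestWeightVector ℓ m (k + 1)) : qCoeff k ℓ m < qCoeff (k + 1) ℓ m := by
  rw [qCoeff_eq_finrank, qCoeff_eq_finrank, Nat.cast_lt]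
  have hsurj : Function.Surjective (raisingMap ℓ m k) := by
    intro y
    obtain ⟨q, hq, hqy⟩ := exists_raising_eq (by zify at hk; omega) y.2
    exact ⟨⟨q, by rwa [Nat.cast_succ]⟩, Subtype.ext hqy⟩
  obtain ⟨p, hp, hEp, hp0⟩ := h
  have hker : LinearMap.ker (raisingMap ℓ m k) ≠ ⊥ :=
    (Submodule.ne_bot_iff _).2 ⟨⟨p, hp⟩, Subtype.ext hEp, fun h0 => hp0 (congrArg Subtype.val h0)⟩
  have h1 := (raisingMap ℓ m k).finrank_range_add_finrank_ker
  rw [LinearMap.range_eq_top.2 hsurj, finrank_top] at h1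
  have h2 := Submodule.one_le_finrank_iff.2 hker
  omega

/-! ### Reduction to the increasing half and splitting of weights -/

theorem floor_half (n : ℕ) : ⌊(n : ℚ) / 2⌋₊ = n / 2 := by
  exact_mod_cast Nat.floor_div_eq_div (K := ℚ) n 2

theorem ceil_half (n : ℕ) : ⌈(n : ℚ) / 2⌉₊ = (n + 1) / 2 := by
  apply le_antisymm
  · rw [Nat.ceil_le, div_le_iff₀ two_pos]
    norm_cast
    omega
  · have h := Nat.le_ceil ((n : ℚ) / 2)
    rw [div_le_iff₀ two_pos] at h
    norm_cast at h
    omega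

theorem strictlyUnimodal_iff (ℓ m : ℕ) :
    StrictlyUnimodal ℓ m ↔
      ∀ i, 1 ≤ i → i + 1 ≤ ℓ * m / 2 → qCoeff i ℓ m < qCoeff (i + 1) ℓ m := by
  rw [StrictlyUnimodal, ← Nat.cast_mul, floor_half, ceil_half]
  refine ⟨fun h => h.1, fun h => ⟨h, qCoeff_symm (by omega), fun i hi hi' => ?_⟩⟩
  rw [qCoeff_symm (show i + 1 + (ℓ * m - (i + 1)) = ℓ * m by omega),
    qCoeff_symm (show i + (ℓ * m - (i + 1) + 1) = ℓ * m by omega)]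
  exact h _ (by omega) (by omega)

theorem StrictlyUnimodal.hasHighestWeightVector {ℓ m k : ℕ} (h : StrictlyUnimodal ℓ m)
    (hk : k ≠ 1) (hk' : k ≤ ℓ * m / 2) : HasHighestWeightVector ℓ m k := by
  rcases k with _ | k
  · exact hasHighestWeightVector_zero ℓ m
  · exact hasHighestWeightVector_of_qCoeff_lt ((strictlyUnimodal_iff ℓ m).1 h k (by omega) hk')

/-- Greedy splitting fails only at `n = a + 1`, where it leaves the forbidden remainder 1; for `a =
b = 2` this failure is genuine. -/
theorem exists_add_eq_of_ne_one {a b n : ℕ} (ha : 2 ≤ a) (hb : 2 ≤ b) (hab : 3 ≤ a ∨ 3 ≤ b)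
    (hn : n ≠ 1) (hn' : n ≤ a + b) :
    ∃ x y, x ≠ 1 ∧ y ≠ 1 ∧ x ≤ a ∧ y ≤ b ∧ x + y = n := by
  rcases Nat.lt_or_ge a n with h | h
  · rcases eq_or_ne n (a + 1) with h1 | h1
    · rcases Nat.lt_or_ge a 3 with h2 | h2
      · exact ⟨0, 3, by omega⟩
      · exact ⟨a - 1, 2, by omega⟩
    · exact ⟨a, n - a, by omega⟩
  · exact ⟨n, 0, by omega⟩

end

theorem lemmal (ℓ m₁ m₂ : ℕ) (hℓ : 2 ≤ ℓ) (hm₁ : 2 ≤ m₁) (hm₂ : 2 ≤ m₂)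
    (h₁ : StrictlyUnimodal ℓ m₁) (h₂ : StrictlyUnimodal ℓ m₂)
    (heven : Even ℓ ∨ Even m₁ ∨ Even m₂) (hthree : 3 ≤ ℓ ∨ 3 ≤ m₁ ∨ 3 ≤ m₂) :
    StrictlyUnimodal ℓ (m₁ + m₂) := by
  have hfour₁ : 2 * 2 ≤ ℓ * m₁ := Nat.mul_le_mul hℓ hm₁
  have hfour₂ : 2 * 2 ≤ ℓ * m₂ := Nat.mul_le_mul hℓ hm₂
  have hsix : 6 ≤ ℓ * m₁ ∨ 6 ≤ ℓ * m₂ := by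
    rcases hthree with h | h | h
    · exact Or.inl (by nlinarith)
    · exact Or.inl (by nlinarith)
    · exact Or.inr (by nlinarith)
  have hparity : Even (ℓ * m₁) ∨ Even (ℓ * m₂) := by
    simp only [Nat.even_mul]
    tauto
  -- Were both products odd, the floors would lose 1 and the middle weight would be out of reach.
  have hhalf : ℓ * (m₁ + m₂) / 2 = ℓ * m₁ / 2 + ℓ * m₂ / 2 := by
    rw [mul_add]
    rcases hparity with ⟨c, hc⟩ | ⟨c, hc⟩ <;> omega
  rw [strictlyUnimodal_iff]
  intro i hi hi'
  obtain ⟨x, y, hx, hy, hxa, hyb, hxy⟩ := exists_add_eq_of_ne_one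
    (a := ℓ * m₁ / 2) (b := ℓ * m₂ / 2) (n := i + 1) (by omega) (by omega) (by omega) (by omega)
    (by omega)
  refine qCoeff_lt_of_hasHighestWeightVector (by omega) ?_
  rw [← hxy]
  exact (h₁.hasHighestWeightVector hx hxa).add (h₂.hasHighestWeightVector hy hyb)
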